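/- **Theorem (Generalized quasi-gradients for linear regression).** Let $n,d\ge 0$ be integers, let $X_1,\dots,X_n\in\mathbb R^d$ and $Y_1,\dots,Y_n\in\mathbb R$, let $\epsilon\in[0,1)$, $\kappa\ge 0$, $\sigma\in\mathbb R$, and let $S\subseteq\{1,\dots,n\}$ be a set of good points with $|S|\ge(1-\epsilon)n$; let $p_S$ be the uniform distribution on $S$. Let $$\Delta_{n,\epsilon}=\Big\{q\in\mathbb R^n : \textstyle\sum_{i=1}^n q_i=1,\ 0\le q_i\le \frac1{(1-\epsilon)n}\Big\},\qquad \mathbb E_q[f(X,Y)]=\textstyle\sum_i q_i f(X_i,Y_i).$$ Let $\mathcal E_4$ be the set of degree-4 pseudoexpectations on the sphere, that is, linear maps $E$ from real polynomials in $v=(v_1,\dots,v_d)$ of degree at most $4$ to $\mathbb R$ with $E[1]=1$, and with $E[p^2]\ge0$ and $E[(\|v\|^2-1)p]=0$ for all polynomials $p$ of degree at most $2$. For each $q\in\Delta_{n,\epsilon}$ let $\theta(q)$ be a minimizer over $\theta\in\mathbb R^d$ of $\mathbb E_q[(Y-\theta^\top X)^2]$ (any choice). With values in $[0,\infty]$,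 a supremum over the empty set being $0$, and with the convention $0/0=0$, define $$\tilde F_1(q)=\sup_{E\in\mathcal E_4}\frac{E[\mathbb E_q[(v^\top X)^4]]}{E[\mathbb E_q[(v^\top X)^2]^2]},\qquad F_2(q)=\sup_{v\in\mathbb R^d}\frac{\mathbb E_q[(Y-\theta(q)^\top X)^2(v^\top X)^2]}{\mathbb E_q[(v^\top X)^2]}.$$ Given a maximizer $E\in\mathcal E_4$ in the definition of $\tilde F_1(q)$ put $\tilde g_1(X_i;q)=E[(v^\top X_i)^4]$; given a maximizer $v\in\mathbb R^d$ in the definition of $F_2(q)$ put $g_2(X_i;q)=(Y_i-\theta(q)^\top X_i)^2(v^\top X_i)^2$. Assume $\tilde F_1(p_S)\le\kappa^2$, $F_2(p_S)\le\sigma^2$ and $\kappa^3\epsilon<1/64$. Then for every $q\in\Delta_{n,\epsilon}$ and for every choice of the maximizers in $\tilde g_1$ and $g_2$: 1. if $\mathbb E_q[\tilde g_1(X;q)]\le\mathbb E_{p_S}[\tilde g_1(X;q)]$, then $\tilde F_1(q)\le 4\,\tilde F_1(p_S)$; 2. if $\tilde F_1(q)\le4\kappa^2$ and $\mathbb E_q[g_2(X;q)]\le\mathbb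 E_{p_S}[g_2(X;q)]$, then $F_2(q)\le 3\,F_2(p_S)$. Say that $g$ is a generalized quasi-gradient for $F$ on a set $A$ with parameter $C\ge1$ relative to $p$ if, for all $q\in A$, $\langle g(q),q-p\rangle\le0$ implies $F(q)\le C\,F(p)$. Thus, relative to $p_S$, $\tilde g_1$ is a generalized quasi-gradient for $\tilde F_1$ on $\Delta_{n,\epsilon}$ with parameter $4$, and $g_2$ is a generalized quasi-gradient for $F_2$ on $\{q\in\Delta_{n,\epsilon}:\tilde F_1(q)\le4\kappa^2\}$ with parameter $3$. -/

import Mathlib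

open scoped ENNReal BigOperators

noncomputable section

namespace RobustRegression

/-! ### Weighted point sets -/

/-- The set of `ε`-deletions of the uniform distribution on `n` points: weight vectors `q` with
total mass one and `0 ≤ q i ≤ 1 / ((1 - ε) n)`. -/
def deletions (n : ℕ) (ε : ℝ) : Set (Fin n → ℝ) :=
  {q | ∑ i, q i = 1 ∧ ∀ i, 0 ≤ q i ∧ q i ≤ 1 / ((1 - ε) * (n : ℝ))}

/-- The weights of the empirical (uniform) distribution on the index set `S`. -/
def empirical {n : ℕ} (S : Finset (Fin n)) : Fin n → ℝ :=
  fun i => if i ∈ S then 1 / (S.card : ℝ) else 0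

/-- Expectation of a function of the data points under the weights `q`. -/
def expect {n : ℕ} (q : Fin n → ℝ) (f : Fin n → ℝ) : ℝ :=
  ∑ i, q i * f i

/-! ### Degree-four pseudoexpectations on the sphere -/

/-- Real polynomials in `v = (v_1, …, v_d)` of degree at most four. -/
abbrev Poly4 (d : ℕ) : Type :=
  MvPolynomial.restrictTotalDegree (Fin d) ℝ 4

/-- The polynomial `‖v‖² - 1`. -/
def sphereEq (d : ℕ) : MvPolynomial (Fin d) ℝ :=
  (∑ j, MvPolynomial.X j ^ 2) - 1

/-- The degree-four pseudoexpectations on the sphere: linear functionals `E` on the polynomials of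
degree at most four with `E[1] = 1`, with `E[p²] ≥ 0` and `E[(‖v‖² - 1) p] = 0` whenever
`deg p ≤ 2`. -/
def pseudoexpectations (d : ℕ) : Set (Poly4 d →ₗ[ℝ] ℝ) :=
  {E | (∀ P : Poly4 d, (P : MvPolynomial (Fin d) ℝ) = 1 → E P = 1) ∧
    (∀ (P : Poly4 d) (p : MvPolynomial (Fin d) ℝ), p.totalDegree ≤ 2 →
      (P : MvPolynomial (Fin d) ℝ) = p ^ 2 → 0 ≤ E P) ∧
    (∀ (P : Poly4 d) (p : MvPolynomial (Fin d) ℝ), p.totalDegree ≤ 2 →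
      (P : MvPolynomial (Fin d) ℝ) = sphereEq d * p → E P = 0)}

/-- The linear form `v ↦ vᵀ x` as a polynomial in `v`. -/
def linForm {d : ℕ} (x : EuclideanSpace ℝ (Fin d)) : MvPolynomial (Fin d) ℝ :=
  ∑ j, MvPolynomial.C (x j) * MvPolynomial.X j

theorem totalDegree_linForm_le {d : ℕ} (x : EuclideanSpace ℝ (Fin d)) :
    (linForm x).totalDegree ≤ 1 := by
  refine MvPolynomial.totalDegree_finsetSum_le fun j _ => ?_
  refine (MvPolynomial.totalDegree_mul _ _).trans ?_
  simp

/-- The second moment `𝔼_q[(vᵀX)²]` as a polynomial in `v`. -/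
def secondMoment {n d : ℕ} (X : Fin n → EuclideanSpace ℝ (Fin d)) (q : Fin n → ℝ) :
    MvPolynomial (Fin d) ℝ :=
  ∑ i, q i • linForm (X i) ^ 2

theorem totalDegree_secondMoment_le {n d : ℕ} (X : Fin n → EuclideanSpace ℝ (Fin d))
    (q : Fin n → ℝ) : (secondMoment X q).totalDegree ≤ 2 := by
  refine MvPolynomial.totalDegree_finsetSum_le fun i _ => ?_
  refine (MvPolynomial.totalDegree_smul_le _ _).trans ?_
  refine (MvPolynomial.totalDegree_pow _ _).trans ?_
  have := totalDegree_linForm_le (X i)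
  omega

/-- The polynomial `(vᵀ x)⁴` in `v`. -/
def fourthPow {d : ℕ} (x : EuclideanSpace ℝ (Fin d)) : Poly4 d :=
  ⟨linForm x ^ 4, by
    rw [MvPolynomial.mem_restrictTotalDegree]
    refine (MvPolynomial.totalDegree_pow _ _).trans ?_
    have := totalDegree_linForm_le x
    omega⟩

/-- The fourth moment `𝔼_q[(vᵀX)⁴]` as a polynomial in `v`. -/
def fourthMoment {n d : ℕ} (X : Fin n → EuclideanSpace ℝ (Fin d)) (q : Fin n → ℝ) : Poly4 d :=
  ∑ i, q i • fourthPow (X i)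

/-- The squared second moment `𝔼_q[(vᵀX)²]²` as a polynomial in `v`. -/
def secondMomentSq {n d : ℕ} (X : Fin n → EuclideanSpace ℝ (Fin d)) (q : Fin n → ℝ) : Poly4 d :=
  ⟨secondMoment X q ^ 2, by
    rw [MvPolynomial.mem_restrictTotalDegree]
    refine (MvPolynomial.totalDegree_pow _ _).trans ?_
    have := totalDegree_secondMoment_le X q
    omega⟩

/-! ### Certifiable hypercontractivity and its quasi-gradient -/

/-- The ratio `E_v[𝔼_q[(vᵀX)⁴]] / E_v[𝔼_q[(vᵀX)²]²]`, with `0 / 0 = 0`. For nonnegative weights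
both terms are nonnegative, and the numerator vanishes whenever the denominator does. -/
def hyperRatio {n d : ℕ} (X : Fin n → EuclideanSpace ℝ (Fin d)) (q : Fin n → ℝ)
    (E : Poly4 d →ₗ[ℝ] ℝ) : ℝ≥0∞ :=
  ENNReal.ofReal (E (fourthMoment X q)) / ENNReal.ofReal (E (secondMomentSq X q))

/-- The certifiable hypercontractivity coefficient `F̃₁(q)`. -/
def F1 {n d : ℕ} (X : Fin n → EuclideanSpace ℝ (Fin d)) (q : Fin n → ℝ) : ℝ≥0∞ :=
  ⨆ E ∈ pseudoexpectations d, hyperRatio X q E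

/-- `E` attains the supremum in the definition of `F̃₁(q)`. -/
def IsMaxPseudoexpectation {n d : ℕ} (X : Fin n → EuclideanSpace ℝ (Fin d)) (q : Fin n → ℝ)
    (E : Poly4 d →ₗ[ℝ] ℝ) : Prop :=
  E ∈ pseudoexpectations d ∧ IsMaxOn (hyperRatio X q) (pseudoexpectations d) E

/-- `g̃₁(X_i; q) = E_v[(vᵀ X_i)⁴]` for a given pseudoexpectation. -/
def g1 {n d : ℕ} (X : Fin n → EuclideanSpace ℝ (Fin d)) (E : Poly4 d →ₗ[ℝ] ℝ) : Fin n → ℝ :=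
  fun i => E (fourthPow (X i))

/-! ### Bounded noise and its quasi-gradient -/

/-- `θ` minimizes the squared loss `𝔼_q[(Y - θᵀX)²]`. -/
def IsLeastSquares {n d : ℕ} (X : Fin n → EuclideanSpace ℝ (Fin d)) (Y : Fin n → ℝ)
    (q : Fin n → ℝ) (θ : EuclideanSpace ℝ (Fin d)) : Prop :=
  ∀ θ' : EuclideanSpace ℝ (Fin d),
    expect q (fun i => (Y i - inner ℝ θ (X i)) ^ 2) ≤
      expect q (fun i => (Y i - inner ℝ θ' (X i)) ^ 2)

/-- `(Y_i - θᵀX_i)² (vᵀX_i)²`; with `θ = θ(q)` and `v` a maximizer this is `g₂(X_i; q)`. -/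
def g2 {n d : ℕ} (X : Fin n → EuclideanSpace ℝ (Fin d)) (Y : Fin n → ℝ)
    (θ v : EuclideanSpace ℝ (Fin d)) : Fin n → ℝ :=
  fun i => (Y i - inner ℝ θ (X i)) ^ 2 * (inner ℝ v (X i)) ^ 2

/-- The ratio `𝔼_q[(Y - θᵀX)² (vᵀX)²] / 𝔼_q[(vᵀX)²]`, with `0 / 0 = 0`. For nonnegative weights
the numerator vanishes whenever the denominator does. -/
def noiseRatio {n d : ℕ} (X : Fin n → EuclideanSpace ℝ (Fin d)) (Y : Fin n → ℝ)
    (q : Fin n → ℝ) (θ v : EuclideanSpace ℝ (Fin d)) : ℝ≥0∞ :=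
  ENNReal.ofReal (expect q (g2 X Y θ v)) /
    ENNReal.ofReal (expect q (fun i => (inner ℝ v (X i)) ^ 2))

/-- The noise level `F₂(q)`, where `θ` assigns to each distribution its regression parameter. -/
def F2 {n d : ℕ} (X : Fin n → EuclideanSpace ℝ (Fin d)) (Y : Fin n → ℝ)
    (θ : (Fin n → ℝ) → EuclideanSpace ℝ (Fin d)) (q : Fin n → ℝ) : ℝ≥0∞ :=
  ⨆ v : EuclideanSpace ℝ (Fin d), noiseRatio X Y q (θ q) v

/-- `v` attains the supremum in the definition of `F₂(q)`. -/
def IsMaxDirection {n d : ℕ} (X : Fin n → EuclideanSpace ℝ (Fin d)) (Y : Fin n → ℝ)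
    (θ : (Fin n → ℝ) → EuclideanSpace ℝ (Fin d)) (q : Fin n → ℝ)
    (v : EuclideanSpace ℝ (Fin d)) : Prop :=
  ∀ w : EuclideanSpace ℝ (Fin d), noiseRatio X Y q (θ q) w ≤ noiseRatio X Y q (θ q) v

/-! ### Generalized quasi-gradients -/

/-- `g` is a generalized quasi-gradient on `A` for `F`, with parameter `C ≥ 1`, relative to the
comparison distribution `p`: for all `q ∈ A`, if `⟨g(q), q - p⟩ ≤ 0` then `F(q) ≤ C F(p)`. -/
def IsGeneralizedQuasiGradient {n : ℕ} (A : Set (Fin n → ℝ)) (p : Fin n → ℝ)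
    (F : (Fin n → ℝ) → ℝ≥0∞) (g : (Fin n → ℝ) → Fin n → ℝ) (C : ℝ≥0∞) : Prop :=
  1 ≤ C ∧ ∀ q ∈ A, ∑ i, g q i * (q i - p i) ≤ 0 → F q ≤ C * F p

end RobustRegression

end

open RobustRegression

/-!
Both halves compare `p = p_S` with a deletion `q`. Two `ε`-deletions differ only by parts `p - m`
and `q - m`, `m = min p q`, of mass at most `τ = ε / (1 - ε)` (`sum_sub_min_le`). As soon as some
second moment under `p` is nonzero, hypercontractivity forces `κ ≥ 1`, and then `κ² τ ≤ 1 / 63`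
(`sq_mul_div_le`). In the degenerate case the expectation of the quasi-gradient under `p`, hence
under `q`, vanishes.

*Hypercontractivity.* For a pseudoexpectation `E`, the map `w ↦ E[𝔼_w[(vᵀX)²]²]` is a positive
semidefinite quadratic form in the signed weights `w`, at most
`(∑ |w_i|) ∑ |w_i| E[(vᵀX_i)⁴]` by Cauchy–Schwarz (`apply_secondMomentSq_le`). Take `w = p - q`.
If `q` has no larger fourth moment than `p`, this value is at most `4 τ F̃₁(p) E[𝔼_p[(vᵀX)²]²]`, a
small multiple of the value at `p`. So the value at `p` is at most four times the value at `q`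
(`expect_g1_le`). This compares the denominators of the two ratios; the numerators are compared by
hypothesis.

*Noise.* Evaluation at a unit vector is a pseudoexpectation, so the fourth moments of `p` and `q`
are controlled in every direction (`expect_inner_pow_four_le`), and a part of small mass carries
little of a second moment (`expect_sq_le_mul`). By the normal equations, the difference
`h = (θ(p) - θ(q))ᵀX` of the residuals is orthogonal to the residual of `p` under `p` and to that
of `q` under `q`. Hence its second moment on the overlap `m` is a correlation of the residuals
with `h` over `p - m` and `q - m` only, and it is at most of the order of
`τ (√F₂(p) + √F₂(q))²`. Minkowski's inequality in `L²(p)` then bounds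
`√𝔼_p[(Y - θ(q)ᵀX)² (vᵀX)²]` by a combination of `√F₂(p)` and `√F₂(q)` whose coefficient at
`√F₂(q)` is small, and this term can be absorbed (`noise_level_sq_le`).
-/

namespace RobustRegression

open Finset

/-! ### Weighted averages -/

section Expect

variable {n : ℕ} {p q w f : Fin n → ℝ}

theorem expect_nonneg (hw : ∀ i, 0 ≤ w i) (hf : ∀ i, 0 ≤ f i) : 0 ≤ expect w f :=
  sum_nonneg fun i _ => mul_nonneg (hw i) (hf i)

theorem expect_mono_weights (hpq : ∀ i, p i ≤ q i) (hf : ∀ i, 0 ≤ f i) :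
    expect p f ≤ expect q f :=
  sum_le_sum fun i _ => mul_le_mul_of_nonneg_right (hpq i) (hf i)

theorem expect_add (w f g : Fin n → ℝ) :
    expect w (fun i => f i + g i) = expect w f + expect w g := by
  simp only [expect, mul_add, sum_add_distrib]

theorem expect_sub_weights (p q f : Fin n → ℝ) :
    expect (fun i => p i - q i) f = expect p f - expect q f := by
  simp only [expect, sub_mul, sum_sub_distrib]

theorem expect_const_mul (w f : Fin n → ℝ) (c : ℝ) :
    expect w (fun i => c * f i) = c * expect w f := by
  simp only [expect, mul_sum]
  exact sum_congr rfl fun i _ => by ring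

theorem expect_mul_sq_le (hw : ∀ i, 0 ≤ w i) (f g : Fin n → ℝ) :
    expect w (fun i => f i * g i) ^ 2 ≤
      expect w (fun i => f i ^ 2) * expect w (fun i => g i ^ 2) :=
  sum_sq_le_sum_mul_sum_of_sq_le_mul _ (fun i _ => mul_nonneg (hw i) (sq_nonneg _))
    (fun i _ => mul_nonneg (hw i) (sq_nonneg _)) fun i _ => le_of_eq (by ring)

/-- A part `w` of the distribution `p` with mass at most `τ` contributes at most
`√(τ 𝔼_p[f²])` to the expectation of `f`. -/
theorem expect_sq_le_of_le {τ : ℝ} (hw : ∀ i, 0 ≤ w i) (hwp : ∀ i, w i ≤ p i)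
    (hτ : ∑ i, w i ≤ τ) (f : Fin n → ℝ) :
    expect w f ^ 2 ≤ τ * expect p (fun i => f i ^ 2) := by
  have h := expect_mul_sq_le hw (fun _ => 1) f
  simp only [one_mul, one_pow] at h
  have h1 : expect w (fun _ => (1 : ℝ)) ≤ τ := by simpa [expect] using hτ
  refine h.trans (mul_le_mul h1 (expect_mono_weights hwp fun i => sq_nonneg _)
    (expect_nonneg hw fun i => sq_nonneg _) ((sum_nonneg fun i _ => hw i).trans hτ))

/-- Minkowski's inequality in `L²`, without square roots. -/
theorem expect_add_sq_le (hw : ∀ i, 0 ≤ w i) (f g : Fin n → ℝ) {a b : ℝ} (ha : 0 ≤ a)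
    (hb : 0 ≤ b) (hf : expect w (fun i => f i ^ 2) ≤ a ^ 2)
    (hg : expect w (fun i => g i ^ 2) ≤ b ^ 2) :
    expect w (fun i => (f i + g i) ^ 2) ≤ (a + b) ^ 2 := by
  have hc : expect w (fun i => f i * g i) ≤ a * b := by
    refine abs_le_of_sq_le_sq' ?_ (mul_nonneg ha hb) |>.2
    rw [mul_pow]
    exact (expect_mul_sq_le hw f g).trans (mul_le_mul hf hg
      (expect_nonneg hw fun i => sq_nonneg _) (sq_nonneg _))
  have he : expect w (fun i => (f i + g i) ^ 2) =
      expect w (fun i => f i ^ 2) + expect w (fun i => g i ^ 2)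
        + 2 * expect w (fun i => f i * g i) := by
    rw [← expect_add, ← expect_const_mul, ← expect_add]
    congr 1; ext i; ring
  nlinarith

end Expect

/-! ### Deletions and their overlap -/

section Deletions

variable {n : ℕ} {ε : ℝ} {p q : Fin n → ℝ}

theorem pos_of_mem_deletions (hq : q ∈ deletions n ε) : 0 < n := by
  rcases Nat.eq_zero_or_pos n with rfl | h
  · simpa using hq.1
  · exact h

theorem empirical_mem_deletions {S : Finset (Fin n)} (hε : ε < 1) (hn : 0 < n)
    (hS : (1 - ε) * (n : ℝ) ≤ (S.card : ℝ)) : empirical S ∈ deletions n ε := by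
  have hpos : 0 < (1 - ε) * (n : ℝ) := mul_pos (by linarith) (by exact_mod_cast hn)
  refine ⟨?_, fun i => ?_⟩
  · simp [empirical, sum_ite_mem, (hpos.trans_le hS).ne']
  · unfold empirical
    split_ifs
    · exact ⟨by positivity, one_div_le_one_div_of_le hpos hS⟩
    · exact ⟨le_rfl, by positivity⟩

/-- Two deletions overlap in all but a fraction `ε / (1 - ε)` of their mass. -/
theorem sum_sub_min_le (hε : ε < 1) (hp : p ∈ deletions n ε) (hq : q ∈ deletions n ε) :
    ∑ i, (q i - min (p i) (q i)) ≤ ε / (1 - ε) := by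
  have hn : (0 : ℝ) < n := by exact_mod_cast pos_of_mem_deletions hq
  have h1 : 0 < 1 - ε := by linarith
  calc ∑ i, (q i - min (p i) (q i)) ≤ ∑ i, (1 / ((1 - ε) * (n : ℝ)) - p i) := by
        refine sum_le_sum fun i _ => ?_
        have hp' := hp.2 i
        have hq' := hq.2 i
        rcases min_cases (p i) (q i) with ⟨h, _⟩ | ⟨h, _⟩ <;> rw [h] <;> linarith
    _ = ε / (1 - ε) := by
        rw [sum_sub_distrib, hp.1]
        simp only [sum_const, card_univ, Fintype.card_fin, nsmul_eq_mul]
        field_simp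
        ring

theorem sum_abs_sub_le (hε : ε < 1) (hp : p ∈ deletions n ε) (hq : q ∈ deletions n ε) :
    ∑ i, |p i - q i| ≤ 2 * (ε / (1 - ε)) := by
  have h1 := sum_sub_min_le hε hp hq
  have h2 := sum_sub_min_le hε hq hp
  have : ∑ i, |p i - q i| =
      ∑ i, (q i - min (p i) (q i)) + ∑ i, (p i - min (q i) (p i)) := by
    rw [← sum_add_distrib]
    refine sum_congr rfl fun i _ => ?_
    rcases le_total (p i) (q i) with h | h
    · rw [min_eq_left h, min_eq_right h, abs_of_nonpos (by linarith)]; ring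
    · rw [min_eq_right h, min_eq_left h, abs_of_nonneg (by linarith)]; ring
  linarith

theorem sq_mul_div_le {κ : ℝ} (hε0 : 0 ≤ ε) (hκ1 : 1 ≤ κ)
    (h : κ ^ 3 * ε < 1 / 64) : κ ^ 2 * (ε / (1 - ε)) ≤ 1 / 63 := by
  have h2 : κ ^ 2 ≤ κ ^ 3 := pow_le_pow_right₀ hκ1 (by norm_num)
  have h3 : 1 ≤ κ ^ 2 := one_le_pow₀ hκ1
  have h4 : κ ^ 2 * ε < 1 / 64 := (mul_le_mul_of_nonneg_right h2 hε0).trans_lt h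
  have h5 : ε < 1 / 64 := (le_mul_of_one_le_left hε0 h3).trans_lt h4
  rw [← mul_div_assoc, div_le_iff₀ (by linarith)]
  linarith

end Deletions

/-! ### Ratios with values in `[0, ∞]` -/

/-- In `ℝ≥0∞`, `a / 0 = ∞` unless `a = 0`, so bounding a ratio by a real number is the same as
bounding its numerator, also when the denominator vanishes. -/
theorem ofReal_div_ofReal_le_iff {a b c : ℝ} (hb : 0 ≤ b) (hc : 0 ≤ c) :
    ENNReal.ofReal a / ENNReal.ofReal b ≤ ENNReal.ofReal c ↔ a ≤ c * b := by
  rcases hb.eq_or_lt with rfl | hb'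
  · rw [ENNReal.ofReal_zero, mul_zero]
    constructor
    · intro h
      by_contra! ha
      rw [ENNReal.div_zero (by simpa using ha)] at h
      exact absurd h (by simp)
    · intro h
      simp [ENNReal.ofReal_of_nonpos h]
  · rw [ENNReal.div_le_iff (by simpa using hb') (by simp), ← ENNReal.ofReal_mul hc,
      ENNReal.ofReal_le_ofReal_iff (by positivity)]

/-! ### The Gram matrix of a pseudoexpectation -/

section Pseudo

variable {n d : ℕ} {X : Fin n → EuclideanSpace ℝ (Fin d)} {E : Poly4 d →ₗ[ℝ] ℝ}

/-- The polynomial `(vᵀ x)² (vᵀ y)²` in `v`. -/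
noncomputable def sqMulSq (x y : EuclideanSpace ℝ (Fin d)) : Poly4 d :=
  ⟨linForm x ^ 2 * linForm y ^ 2, by
    rw [MvPolynomial.mem_restrictTotalDegree]
    have hx := totalDegree_linForm_le x
    have hy := totalDegree_linForm_le y
    have h1 := MvPolynomial.totalDegree_mul (linForm x ^ 2) (linForm y ^ 2)
    have h2 := MvPolynomial.totalDegree_pow (linForm x) 2
    have h3 := MvPolynomial.totalDegree_pow (linForm y) 2
    omega⟩

theorem apply_fourthMoment (X : Fin n → EuclideanSpace ℝ (Fin d)) (q : Fin n → ℝ)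
    (E : Poly4 d →ₗ[ℝ] ℝ) : E (fourthMoment X q) = expect q (g1 X E) := by
  simp [fourthMoment, expect, g1, map_sum]

theorem apply_secondMomentSq (X : Fin n → EuclideanSpace ℝ (Fin d)) (q : Fin n → ℝ)
    (E : Poly4 d →ₗ[ℝ] ℝ) :
    E (secondMomentSq X q) = ∑ i, ∑ j, q i * q j * E (sqMulSq (X i) (X j)) := by
  have : secondMomentSq X q = ∑ i, ∑ j, (q i * q j) • sqMulSq (X i) (X j) := by
    apply Subtype.ext
    simp only [secondMomentSq, secondMoment, sqMulSq, AddSubmonoidClass.coe_finsetSum,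
      Submodule.coe_smul, sq (∑ i, q i • linForm (X i) ^ 2), sum_mul_sum, smul_mul_smul_comm]
  simp [this, map_sum]

theorem apply_secondMomentSq_nonneg (hE : E ∈ pseudoexpectations d)
    (X : Fin n → EuclideanSpace ℝ (Fin d)) (q : Fin n → ℝ) : 0 ≤ E (secondMomentSq X q) :=
  hE.2.1 _ _ (totalDegree_secondMoment_le X q) rfl

theorem g1_nonneg (hE : E ∈ pseudoexpectations d) (X : Fin n → EuclideanSpace ℝ (Fin d))
    (i : Fin n) : 0 ≤ g1 X E i := by
  refine hE.2.1 _ (linForm (X i) ^ 2) ?_ ?_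
  · have h1 := totalDegree_linForm_le (X i)
    have h2 := MvPolynomial.totalDegree_pow (linForm (X i)) 2
    omega
  · simp only [fourthPow]; ring

/-- The arithmetic–geometric mean inequality for pseudoexpectations, from the squares
`((vᵀx)² ± (vᵀy)²)²`. -/
theorem two_mul_abs_apply_sqMulSq_le (hE : E ∈ pseudoexpectations d)
    (x y : EuclideanSpace ℝ (Fin d)) :
    2 * |E (sqMulSq x y)| ≤ E (fourthPow x) + E (fourthPow y) := by
  have key : ∀ c : ℝ, c ^ 2 = 1 →
      0 ≤ E (fourthPow x) + E (fourthPow y) + 2 * c * E (sqMulSq x y) := by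
    intro c hc
    have h := hE.2.1 (fourthPow x + fourthPow y + (2 * c) • sqMulSq x y)
      (linForm x ^ 2 + c • linForm y ^ 2) ?_ ?_
    · simpa using h
    · have hx := totalDegree_linForm_le x
      have hy := totalDegree_linForm_le y
      have h1 := MvPolynomial.totalDegree_add (linForm x ^ 2) (c • linForm y ^ 2)
      have h2 := MvPolynomial.totalDegree_pow (linForm x) 2
      have h3 := MvPolynomial.totalDegree_pow (linForm y) 2
      have h4 := MvPolynomial.totalDegree_smul_le c (linForm y ^ 2)
      have h5 := max_le (h2.trans (by omega : _ ≤ 2)) (h4.trans (by omega : _ ≤ 2))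
      exact h1.trans h5
    · have hC : (MvPolynomial.C c : MvPolynomial (Fin d) ℝ) ^ 2 = 1 := by
        rw [← map_pow, hc, map_one]
      simp only [fourthPow, sqMulSq, Submodule.coe_add, Submodule.coe_smul,
        MvPolynomial.smul_eq_C_mul, map_mul, map_ofNat]
      linear_combination (-linForm y ^ 4) * hC
  have h1 := key 1 (by norm_num)
  have h2 := key (-1) (by norm_num)
  rcases abs_cases (E (sqMulSq x y)) with ⟨h, _⟩ | ⟨h, _⟩ <;> rw [h] <;> linarith

/-- Cauchy–Schwarz for signed weights:
`E[(∑ w_i (vᵀX_i)²)²] ≤ (∑ |w_i|) ∑ |w_i| E[(vᵀX_i)⁴]`. -/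
theorem apply_secondMomentSq_le (hE : E ∈ pseudoexpectations d)
    (X : Fin n → EuclideanSpace ℝ (Fin d)) (w : Fin n → ℝ) :
    E (secondMomentSq X w) ≤ (∑ i, |w i|) * ∑ i, |w i| * g1 X E i := by
  have h : ∀ i j, w i * w j * E (sqMulSq (X i) (X j)) ≤
      (|w i| * (|w j| * g1 X E j) + |w j| * (|w i| * g1 X E i)) / 2 := by
    intro i j
    have h1 := two_mul_abs_apply_sqMulSq_le hE (X i) (X j)
    have h2 := le_abs_self (w i * w j * E (sqMulSq (X i) (X j)))
    rw [abs_mul, abs_mul] at h2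
    have h3 := mul_le_mul_of_nonneg_left h1 (mul_nonneg (abs_nonneg (w i)) (abs_nonneg (w j)))
    simp only [g1]
    linarith
  calc E (secondMomentSq X w)
      ≤ ∑ i, ∑ j, (|w i| * (|w j| * g1 X E j) + |w j| * (|w i| * g1 X E i)) / 2 := by
        rw [apply_secondMomentSq]
        exact sum_le_sum fun i _ => sum_le_sum fun j _ => h i j
    _ = (∑ i, |w i|) * ∑ i, |w i| * g1 X E i := by
        simp only [← sum_div, sum_add_distrib]
        rw [sum_comm (f := fun i j => |w j| * (|w i| * g1 X E i)), ← sum_mul_sum]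
        ring

/-- The parallelogram inequality for the seminorm `p ↦ √E[𝔼_p[(vᵀX)²]²]`. -/
theorem apply_secondMomentSq_le_add (hE : E ∈ pseudoexpectations d)
    (X : Fin n → EuclideanSpace ℝ (Fin d)) (p q : Fin n → ℝ) :
    E (secondMomentSq X p) ≤
      2 * E (secondMomentSq X q) + 2 * E (secondMomentSq X (fun i => p i - q i)) := by
  have h := apply_secondMomentSq_nonneg hE X (fun i => 2 * q i - p i)
  have he : E (secondMomentSq X (fun i => 2 * q i - p i)) = 2 * E (secondMomentSq X q) +
      2 * E (secondMomentSq X (fun i => p i - q i)) - E (secondMomentSq X p) := by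
    simp only [apply_secondMomentSq, mul_sum, ← sum_add_distrib, ← sum_sub_distrib]
    exact sum_congr rfl fun i _ => sum_congr rfl fun j _ => by ring
  linarith

theorem hyperRatio_le_iff {q : Fin n → ℝ} {c : ℝ} (hE : E ∈ pseudoexpectations d)
    (hc : 0 ≤ c) : hyperRatio X q E ≤ ENNReal.ofReal c ↔
      expect q (g1 X E) ≤ c * E (secondMomentSq X q) := by
  rw [hyperRatio, ofReal_div_ofReal_le_iff (apply_secondMomentSq_nonneg hE X q) hc,
    apply_fourthMoment]

/-- If `E[𝔼_q[(vᵀX)⁴]] ≤ E[𝔼_p[(vᵀX)⁴]]` and `p` is hypercontractive, then the denominators of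
the hypercontractivity ratios of `p` and `q` are comparable, so the ratio of `q` is at most four
times that of `p`. -/
theorem expect_g1_le {ε κ F : ℝ} {p q : Fin n → ℝ} (hE : E ∈ pseudoexpectations d)
    (hε0 : 0 ≤ ε) (hε1 : ε < 1) (hκ : 0 ≤ κ) (hκε : κ ^ 3 * ε < 1 / 64)
    (hp : p ∈ deletions n ε) (hq : q ∈ deletions n ε) (hF0 : 0 ≤ F) (hFκ : F ≤ κ ^ 2)
    (hF : expect p (g1 X E) ≤ F * E (secondMomentSq X p))
    (hqp : expect q (g1 X E) ≤ expect p (g1 X E)) :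
    expect q (g1 X E) ≤ 4 * F * E (secondMomentSq X q) := by
  have hBq := apply_secondMomentSq_nonneg hE X q
  rcases (apply_secondMomentSq_nonneg hE X p).eq_or_lt with hB | hB
  · rw [← hB, mul_zero] at hF
    exact (hqp.trans hF).trans (by positivity)
  have hBA : E (secondMomentSq X p) ≤ expect p (g1 X E) := by
    have h := apply_secondMomentSq_le hE X p
    simp only [abs_of_nonneg (hp.2 _).1, hp.1, one_mul] at h
    exact h
  -- a nondegenerate hypercontractivity coefficient is at least one
  have hF1 : 1 ≤ F := by
    by_contra! h
    have := mul_lt_mul_of_pos_right h hB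
    linarith
  have hκ1 : 1 ≤ κ := by
    by_contra! h
    have := pow_lt_one₀ hκ h two_ne_zero
    linarith
  have hτ := sq_mul_div_le hε0 hκ1 hκε
  have hτ0 : 0 ≤ ε / (1 - ε) := div_nonneg hε0 (by linarith)
  have hA : ∑ i, |p i - q i| * g1 X E i ≤ 2 * (F * E (secondMomentSq X p)) := by
    have : ∑ i, |p i - q i| * g1 X E i ≤ expect p (g1 X E) + expect q (g1 X E) := by
      rw [expect, expect, ← sum_add_distrib]
      refine sum_le_sum fun i _ => ?_
      rw [← add_mul]
      refine mul_le_mul_of_nonneg_right ?_ (g1_nonneg hE X i)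
      have h1 := (hp.2 i).1
      have h2 := (hq.2 i).1
      rw [abs_le]; constructor <;> linarith
    linarith
  have hD : E (secondMomentSq X (fun i => p i - q i)) ≤ 4 / 63 * E (secondMomentSq X p) := by
    refine (apply_secondMomentSq_le hE X _).trans ?_
    refine (mul_le_mul (sum_abs_sub_le hε1 hp hq) hA
      (sum_nonneg fun i _ => mul_nonneg (abs_nonneg _) (g1_nonneg hE X i))
      (by positivity)).trans ?_
    have h1 : F * (ε / (1 - ε)) ≤ 1 / 63 := (mul_le_mul_of_nonneg_right hFκ hτ0).trans hτ
    have h2 := mul_le_mul_of_nonneg_right h1 hB.le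
    linarith
  have hpar := apply_secondMomentSq_le_add hE X p q
  have hpq : E (secondMomentSq X p) ≤ 4 * E (secondMomentSq X q) := by linarith
  have := mul_le_mul_of_nonneg_left hpq hF0
  linarith

end Pseudo

/-! ### Point evaluations as pseudoexpectations -/

section Eval

variable {n d : ℕ}

/-- Evaluation at a point `v`, as a linear functional on polynomials of degree at most four. -/
noncomputable def evalAt (v : EuclideanSpace ℝ (Fin d)) : Poly4 d →ₗ[ℝ] ℝ :=
  (MvPolynomial.aeval (fun j => v j)).toLinearMap ∘ₗ Submodule.subtype _

theorem evalAt_apply (v : EuclideanSpace ℝ (Fin d)) (P : Poly4 d) :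
    evalAt v P = MvPolynomial.eval (fun j => v j) (P : MvPolynomial (Fin d) ℝ) := by
  simp [evalAt, MvPolynomial.aeval_eq_eval]

theorem eval_linForm (v x : EuclideanSpace ℝ (Fin d)) :
    MvPolynomial.eval (fun j => v j) (linForm x) = inner ℝ v x := by
  simp [linForm, PiLp.inner_apply]

theorem evalAt_mem_pseudoexpectations {v : EuclideanSpace ℝ (Fin d)} (hv : ‖v‖ = 1) :
    evalAt v ∈ pseudoexpectations d := by
  refine ⟨fun P hP => ?_, fun P p _ hP => ?_, fun P p _ hP => ?_⟩
  · simp [evalAt_apply, hP]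
  · rw [evalAt_apply, hP, map_pow]
    positivity
  · have h : ∑ j, v j ^ 2 = 1 := by
      rw [← EuclideanSpace.real_norm_sq_eq, hv, one_pow]
    simp [evalAt_apply, hP, sphereEq, h]

theorem g1_evalAt (X : Fin n → EuclideanSpace ℝ (Fin d)) (v : EuclideanSpace ℝ (Fin d)) :
    g1 X (evalAt v) = fun i => inner ℝ v (X i) ^ 4 := by
  ext i
  simp [g1, evalAt_apply, fourthPow, eval_linForm]

theorem evalAt_secondMomentSq (X : Fin n → EuclideanSpace ℝ (Fin d)) (q : Fin n → ℝ)
    (v : EuclideanSpace ℝ (Fin d)) :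
    evalAt v (secondMomentSq X q) = expect q (fun i => inner ℝ v (X i) ^ 2) ^ 2 := by
  simp [evalAt_apply, secondMomentSq, secondMoment, expect, map_sum, eval_linForm,
    MvPolynomial.smul_eval]

/-- Certified hypercontractivity implies hypercontractivity in every direction. -/
theorem expect_inner_pow_four_le {X : Fin n → EuclideanSpace ℝ (Fin d)} {q : Fin n → ℝ} {c : ℝ}
    (hc : 0 ≤ c) (h : F1 X q ≤ ENNReal.ofReal c) (u : EuclideanSpace ℝ (Fin d)) :
    expect q (fun i => inner ℝ u (X i) ^ 4) ≤
      c * expect q (fun i => inner ℝ u (X i) ^ 2) ^ 2 := by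
  rcases eq_or_ne u 0 with rfl | hu
  · simp [expect]
  have hv : ‖(‖u‖⁻¹ • u)‖ = 1 := norm_smul_inv_norm (𝕜 := ℝ) hu
  have hE := evalAt_mem_pseudoexpectations hv
  have h1 := (hyperRatio_le_iff hE hc).1
    ((le_iSup₂ (f := fun E _ => hyperRatio X q E) _ hE).trans h)
  rw [g1_evalAt, evalAt_secondMomentSq] at h1
  simp only [real_inner_smul_left, mul_pow, expect_const_mul] at h1
  have hpos : 0 < ‖u‖⁻¹ ^ 4 := by positivity
  refine le_of_mul_le_mul_left ?_ hpos
  linarith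

end Eval

/-! ### Noise levels of two overlapping distributions -/

section Noise

variable {n : ℕ} {p q : Fin n → ℝ}

/-- If `p` is hypercontractive along `g`, removing a part `w` of small mass removes only a small
fraction of the second moment of `g`. -/
theorem expect_sq_le_mul {w g : Fin n → ℝ} {τ c t : ℝ} (hw : ∀ i, 0 ≤ w i)
    (hwp : ∀ i, w i ≤ p i) (hτ0 : 0 ≤ τ) (hτ : ∑ i, w i ≤ τ) (ht0 : 0 ≤ t)
    (ht : τ * c ≤ t ^ 2)
    (h4 : expect p (fun i => g i ^ 4) ≤ c * expect p (fun i => g i ^ 2) ^ 2) :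
    expect w (fun i => g i ^ 2) ≤ t * expect p (fun i => g i ^ 2) := by
  have hp : ∀ i, 0 ≤ p i := fun i => (hw i).trans (hwp i)
  have h0 := expect_nonneg (f := fun i => g i ^ 2) hp fun i => sq_nonneg _
  refine (abs_le_of_sq_le_sq' ?_ (mul_nonneg ht0 h0)).2
  have h1 := expect_sq_le_of_le hw hwp hτ (fun i => g i ^ 2)
  simp only [← pow_mul] at h1
  have h2 := mul_le_mul_of_nonneg_left h4 hτ0
  have h3 := mul_le_mul_of_nonneg_right ht (sq_nonneg (expect p fun i => g i ^ 2))
  rw [mul_pow]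
  norm_num at h1
  linarith

/-- A part `w` of `p` with mass at most `τ` has correlation at most `√(τ s 𝔼_p[h²])` with `h`, if
the noise `e` has level `s` along `h`; here `κ² τ ≤ t²`, `s = a²` and `𝔼_p[h²] = D²`. -/
theorem mul_abs_expect_mul_le {w e h : Fin n → ℝ} {τ κ t a D : ℝ} (hw : ∀ i, 0 ≤ w i)
    (hwp : ∀ i, w i ≤ p i) (hτ : ∑ i, w i ≤ τ) (ht : 0 ≤ t) (hκτ : κ ^ 2 * τ ≤ t ^ 2)
    (ha : 0 ≤ a) (hD : 0 ≤ D)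
    (hs : expect p (fun i => e i ^ 2 * h i ^ 2) ≤ a ^ 2 * D ^ 2) :
    |κ * expect w (fun i => e i * h i)| ≤ t * (a * D) := by
  have hτ0 : 0 ≤ τ := (sum_nonneg fun i _ => hw i).trans hτ
  refine abs_le_of_sq_le_sq ?_ (by positivity)
  have h1 := expect_sq_le_of_le hw hwp hτ (fun i => e i * h i)
  simp only [mul_pow] at h1
  have h2 := mul_le_mul_of_nonneg_left (h1.trans (mul_le_mul_of_nonneg_left hs hτ0))
    (sq_nonneg κ)
  have h3 := mul_le_mul_of_nonneg_right hκτ (by positivity : 0 ≤ a ^ 2 * D ^ 2)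
  simp only [mul_pow]
  linarith

/-- The comparison of noise levels. The residuals `eq = ep + h` of the two regressions differ by
the function `h`, which is orthogonal to `ep` under `p` and to `eq` under `q`. On the overlap `m`
of `p` and `q` this gives `𝔼_m[h²] = 𝔼_{p-m}[ep h] - 𝔼_{q-m}[eq h]`, which is small, and so
replacing `ep` by `eq` hardly changes the noise level `a²` of `p` along `f`. -/
theorem noise_level_sq_le {ep eq h f : Fin n → ℝ} {τ κ a b : ℝ}
    (hp : ∀ i, 0 ≤ p i) (hq : ∀ i, 0 ≤ q i)
    (hτp : ∑ i, (p i - min (p i) (q i)) ≤ τ) (hτq : ∑ i, (q i - min (p i) (q i)) ≤ τ)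
    (hκ : 0 ≤ κ) (hκτ : κ ^ 2 * τ ≤ 1 / 63)
    (ha : 0 ≤ a) (hb : 0 ≤ b) (heq : ∀ i, eq i = ep i + h i)
    (hpf : expect p (fun i => f i ^ 4) ≤ κ ^ 2 * expect p (fun i => f i ^ 2) ^ 2)
    (hph : expect p (fun i => h i ^ 4) ≤ κ ^ 2 * expect p (fun i => h i ^ 2) ^ 2)
    (hqh : expect q (fun i => h i ^ 4) ≤ 4 * κ ^ 2 * expect q (fun i => h i ^ 2) ^ 2)
    (hop : expect p (fun i => ep i * h i) = 0) (hoq : expect q (fun i => eq i * h i) = 0)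
    (hsf : expect p (fun i => ep i ^ 2 * f i ^ 2) ≤ a ^ 2 * expect p (fun i => f i ^ 2))
    (hsh : expect p (fun i => ep i ^ 2 * h i ^ 2) ≤ a ^ 2 * expect p (fun i => h i ^ 2))
    (hth : expect q (fun i => eq i ^ 2 * h i ^ 2) ≤ b ^ 2 * expect q (fun i => h i ^ 2))
    (htf : b ^ 2 * expect q (fun i => f i ^ 2) ≤ expect p (fun i => eq i ^ 2 * f i ^ 2))
    (hpos : 0 < expect p (fun i => f i ^ 2)) :
    b ^ 2 ≤ 3 * a ^ 2 := by
  set m : Fin n → ℝ := fun i => min (p i) (q i) with hm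
  have hm0 : ∀ i, 0 ≤ m i := fun i => le_min (hp i) (hq i)
  have hmp : ∀ i, m i ≤ p i := fun i => min_le_left _ _
  have hmq : ∀ i, m i ≤ q i := fun i => min_le_right _ _
  have hr0 : ∀ i, 0 ≤ p i - m i := fun i => sub_nonneg.2 (hmp i)
  have hr0' : ∀ i, 0 ≤ q i - m i := fun i => sub_nonneg.2 (hmq i)
  have hrp : ∀ i, p i - m i ≤ p i := fun i => sub_le_self _ (hm0 i)
  have hrq : ∀ i, q i - m i ≤ q i := fun i => sub_le_self _ (hm0 i)
  have hτ0 : 0 ≤ τ := (sum_nonneg fun i _ => hr0 i).trans hτp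
  -- `13 / 100` is slightly more than `√(1 / 63)`
  have ht : κ ^ 2 * τ ≤ (13 / 100) ^ 2 := hκτ.trans (by norm_num)
  have cf := expect_sq_le_mul hr0 hrp hτ0 hτp (t := 13 / 100) (by norm_num)
    (by linarith) hpf
  have ch := expect_sq_le_mul hr0 hrp hτ0 hτp (t := 13 / 100) (by norm_num)
    (by linarith) hph
  have ch' := expect_sq_le_mul hr0' hrq hτ0 hτq (t := 26 / 100) (by norm_num)
    (by linarith) hqh
  rw [expect_sub_weights] at cf ch ch'
  have mf := expect_mono_weights (f := fun i => f i ^ 2) hmq fun i => sq_nonneg _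
  have mh := expect_mono_weights (f := fun i => h i ^ 2) hmq fun i => sq_nonneg _
  obtain ⟨P, hP, hP2⟩ : ∃ P : ℝ, 0 ≤ P ∧ expect p (fun i => f i ^ 2) = P ^ 2 :=
    ⟨_, Real.sqrt_nonneg _, (Real.sq_sqrt hpos.le).symm⟩
  obtain ⟨D, hD, hD2⟩ : ∃ D : ℝ, 0 ≤ D ∧ expect p (fun i => h i ^ 2) = D ^ 2 :=
    ⟨_, Real.sqrt_nonneg _, (Real.sq_sqrt (expect_nonneg hp fun i => sq_nonneg _)).symm⟩
  obtain ⟨D', hD', hD2'⟩ : ∃ D' : ℝ, 0 ≤ D' ∧ expect q (fun i => h i ^ 2) = D' ^ 2 :=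
    ⟨_, Real.sqrt_nonneg _, (Real.sq_sqrt (expect_nonneg hq fun i => sq_nonneg _)).symm⟩
  rw [hP2] at hpf hsf cf hpos
  rw [hD2] at hph hsh ch
  rw [hD2'] at hth ch' mh
  have hDD : D ≤ 43 / 40 * D' := by
    refine (abs_le_of_sq_le_sq' ?_ (by positivity)).2
    rw [mul_pow]
    linarith [sq_nonneg D']
  have hmh : 74 / 100 * D' ^ 2 ≤ expect m (fun i => h i ^ 2) := by linarith
  have hcross : expect m (fun i => h i ^ 2) = expect (fun i => p i - m i) (fun i => ep i * h i)
      - expect (fun i => q i - m i) (fun i => eq i * h i) := by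
    rw [expect_sub_weights, expect_sub_weights, hop, hoq]
    have : expect m (fun i => eq i * h i) =
        expect m (fun i => ep i * h i) + expect m (fun i => h i ^ 2) := by
      rw [← expect_add]
      congr 1; ext i; rw [heq]; ring
    linarith
  have e1 := mul_abs_expect_mul_le hr0 hrp hτp (by norm_num) ht ha hD hsh
  have e2 := mul_abs_expect_mul_le hr0' hrq hτq (by norm_num) ht hb hD' hth
  have hκD' : 74 / 100 * (κ * D') ≤ 13 / 100 * (b + 43 / 40 * a) := by
    rcases hD'.eq_or_lt with h0 | h0
    · rw [← h0]; simp only [mul_zero]; positivity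
    refine le_of_mul_le_mul_right ?_ h0
    have f1 := (le_abs_self _).trans e1
    have f2 := (neg_abs_le _).trans' (neg_le_neg e2)
    have f3 := mul_le_mul_of_nonneg_left (hmh.trans_eq hcross) hκ
    have f4 := mul_le_mul_of_nonneg_left hDD ha
    linarith
  have hκD : κ * D ≤ 43 / 40 * (κ * D') := by
    have := mul_le_mul_of_nonneg_left hDD hκ
    linarith
  have hhf : expect p (fun i => (h i * f i) ^ 2) ≤ (κ * D * P) ^ 2 := by
    refine (abs_le_of_sq_le_sq' ?_ (sq_nonneg _)).2
    have g1 := expect_mul_sq_le hp (fun i => h i ^ 2) (fun i => f i ^ 2)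
    simp only [← pow_mul] at g1
    norm_num at g1
    have g2 := mul_le_mul hph hpf (expect_nonneg hp fun i => by positivity) (by positivity)
    simp only [mul_pow] at g1 g2 ⊢
    linarith
  have hef : expect p (fun i => (ep i * f i) ^ 2) ≤ (a * P) ^ 2 := by
    simp only [mul_pow]
    exact hsf
  have hsum := expect_add_sq_le hp (fun i => ep i * f i) (fun i => h i * f i)
    (by positivity) (by positivity) hef hhf
  have hsum' : expect p (fun i => eq i ^ 2 * f i ^ 2) ≤ (a + κ * D) ^ 2 * P ^ 2 := by
    refine le_trans (le_of_eq ?_) (hsum.trans (le_of_eq (by ring)))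
    congr 1; ext i; rw [heq]; ring
  have hbP : b ^ 2 * (87 / 100) ≤ (a + κ * D) ^ 2 := by
    refine le_of_mul_le_mul_right ?_ hpos
    have : 87 / 100 * P ^ 2 ≤ expect q (fun i => f i ^ 2) := by linarith
    have := mul_le_mul_of_nonneg_left this (sq_nonneg b)
    linarith
  have hb1 : 932 / 1000 * b ≤ a + κ * D := by
    refine (abs_le_of_sq_le_sq' ?_ (by positivity)).2
    rw [mul_pow]
    linarith [sq_nonneg b]
  have hb2 : b ≤ 17 / 10 * a := by linarith
  have := pow_le_pow_left₀ hb hb2 2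
  rw [mul_pow] at this
  linarith [sq_nonneg a]

end Noise

/-! ### Least squares and the noise ratio -/

section LeastSquares

variable {n d : ℕ} {X : Fin n → EuclideanSpace ℝ (Fin d)} {Y : Fin n → ℝ} {q : Fin n → ℝ}
  {θ : EuclideanSpace ℝ (Fin d)}

/-- The normal equations: least-squares residuals are orthogonal to all linear functions. -/
theorem IsLeastSquares.expect_residual_mul_inner (h : IsLeastSquares X Y q θ)
    (u : EuclideanSpace ℝ (Fin d)) :
    expect q (fun i => (Y i - inner ℝ θ (X i)) * inner ℝ u (X i)) = 0 := by
  set B := expect q (fun i => (Y i - inner ℝ θ (X i)) * inner ℝ u (X i)) with hB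
  set C := expect q (fun i => inner ℝ u (X i) ^ 2) with hC
  have key : ∀ t : ℝ, 0 ≤ t ^ 2 * C + (-2 * t) * B := by
    intro t
    have h1 := h (θ + t • u)
    have h2 : expect q (fun i => (Y i - inner ℝ (θ + t • u) (X i)) ^ 2) =
        expect q (fun i => (Y i - inner ℝ θ (X i)) ^ 2) + (t ^ 2 * C + (-2 * t) * B) := by
      rw [hB, hC, ← expect_const_mul, ← expect_const_mul, ← expect_add, ← expect_add]
      congr 1; ext i
      rw [inner_add_left, real_inner_smul_left]
      ring
    linarith
  have hd := discrim_le_zero (a := C) (b := -2 * B) (c := 0) fun t => by linarith [key t]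
  rw [discrim] at hd
  nlinarith

theorem noiseRatio_le_iff {c : ℝ} {v : EuclideanSpace ℝ (Fin d)} (hq : ∀ i, 0 ≤ q i)
    (hc : 0 ≤ c) : noiseRatio X Y q θ v ≤ ENNReal.ofReal c ↔
      expect q (g2 X Y θ v) ≤ c * expect q (fun i => inner ℝ v (X i) ^ 2) :=
  ofReal_div_ofReal_le_iff (expect_nonneg hq fun _ => sq_nonneg _) hc

end LeastSquares

section Main

variable {n d : ℕ} {X : Fin n → EuclideanSpace ℝ (Fin d)} {Y : Fin n → ℝ} {ε κ : ℝ}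
  {p q : Fin n → ℝ}

/-- A weight function without mass on the second moment along `v` has none on `g₂` either. -/
theorem expect_g2_eq_zero {θ v : EuclideanSpace ℝ (Fin d)} (hp : ∀ i, 0 ≤ p i)
    (h : expect p (fun i => inner ℝ v (X i) ^ 2) = 0) : expect p (g2 X Y θ v) = 0 := by
  have h1 := (sum_eq_zero_iff_of_nonneg fun i _ => mul_nonneg (hp i) (sq_nonneg _)).1 h
  refine sum_eq_zero fun i hi => ?_
  have := h1 i hi
  simp only [g2]
  linear_combination (Y i - inner ℝ θ (X i)) ^ 2 * this

theorem F1_le_four_mul {E : Poly4 d →ₗ[ℝ] ℝ} (hε0 : 0 ≤ ε) (hε1 : ε < 1) (hκ : 0 ≤ κ)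
    (hκε : κ ^ 3 * ε < 1 / 64) (hp : p ∈ deletions n ε) (hq : q ∈ deletions n ε)
    (hF1 : F1 X p ≤ ENNReal.ofReal (κ ^ 2)) (hE : IsMaxPseudoexpectation X q E)
    (hqp : expect q (g1 X E) ≤ expect p (g1 X E)) : F1 X q ≤ 4 * F1 X p := by
  have hfin : F1 X p ≠ ∞ := (hF1.trans_lt ENNReal.ofReal_lt_top).ne
  obtain ⟨F, hF0, hF⟩ : ∃ F : ℝ, 0 ≤ F ∧ F1 X p = ENNReal.ofReal F :=
    ⟨_, ENNReal.toReal_nonneg, (ENNReal.ofReal_toReal hfin).symm⟩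
  have hFκ : F ≤ κ ^ 2 := by
    rw [hF] at hF1
    exact (ENNReal.ofReal_le_ofReal_iff (sq_nonneg κ)).1 hF1
  have h1 : hyperRatio X p E ≤ ENNReal.ofReal F :=
    hF ▸ le_iSup₂ (f := fun E _ => hyperRatio X p E) E hE.1
  have h2 := expect_g1_le hE.1 hε0 hε1 hκ hκε hp hq hF0 hFκ
    ((hyperRatio_le_iff hE.1 hF0).1 h1) hqp
  have h4 : (4 : ℝ≥0∞) * ENNReal.ofReal F = ENNReal.ofReal (4 * F) := by
    rw [ENNReal.ofReal_mul (by norm_num)]; norm_num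
  rw [hF, h4]
  exact iSup₂_le fun E' hE' =>
    (hE.2 hE').trans ((hyperRatio_le_iff hE.1 (by positivity)).2 h2)

theorem F2_le_three_mul {θ : (Fin n → ℝ) → EuclideanSpace ℝ (Fin d)}
    {v : EuclideanSpace ℝ (Fin d)} (hε0 : 0 ≤ ε) (hε1 : ε < 1) (hκ : 0 ≤ κ)
    (hκε : κ ^ 3 * ε < 1 / 64) (hp : p ∈ deletions n ε) (hq : q ∈ deletions n ε)
    (hθp : IsLeastSquares X Y p (θ p)) (hθq : IsLeastSquares X Y q (θ q))
    (hF1 : F1 X p ≤ ENNReal.ofReal (κ ^ 2)) (hF1q : F1 X q ≤ ENNReal.ofReal (4 * κ ^ 2))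
    (hF2 : F2 X Y θ p ≠ ∞) (hv : IsMaxDirection X Y θ q v)
    (hqp : expect q (g2 X Y (θ q) v) ≤ expect p (g2 X Y (θ q) v)) :
    F2 X Y θ q ≤ 3 * F2 X Y θ p := by
  have hp0 : ∀ i, 0 ≤ p i := fun i => (hp.2 i).1
  have hq0 : ∀ i, 0 ≤ q i := fun i => (hq.2 i).1
  obtain ⟨s, hs0, hs⟩ : ∃ s : ℝ, 0 ≤ s ∧ F2 X Y θ p = ENNReal.ofReal s :=
    ⟨_, ENNReal.toReal_nonneg, (ENNReal.ofReal_toReal hF2).symm⟩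
  have hsu : ∀ u, expect p (g2 X Y (θ p) u) ≤ s * expect p (fun i => inner ℝ u (X i) ^ 2) :=
    fun u => (noiseRatio_le_iff hp0 hs0).1
      (hs ▸ le_iSup (fun u => noiseRatio X Y p (θ p) u) u)
  have h3 : (3 : ℝ≥0∞) * ENNReal.ofReal s = ENNReal.ofReal (3 * s) := by
    rw [ENNReal.ofReal_mul (by norm_num)]; norm_num
  rw [hs, h3]
  refine iSup_le fun w => (hv w).trans ((noiseRatio_le_iff hq0 (by positivity)).2 ?_)
  have hN0 : 0 ≤ expect q (g2 X Y (θ q) v) :=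
    expect_nonneg hq0 fun i => mul_nonneg (sq_nonneg _) (sq_nonneg _)
  have hqv0 : 0 ≤ expect q (fun i => inner ℝ v (X i) ^ 2) :=
    expect_nonneg hq0 fun i => sq_nonneg _
  have hpv0 : 0 ≤ expect p (fun i => inner ℝ v (X i) ^ 2) :=
    expect_nonneg hp0 fun i => sq_nonneg _
  rcases hpv0.eq_or_lt with hpv | hpv
  · rw [expect_g2_eq_zero hp0 hpv.symm] at hqp
    exact hqp.trans (by positivity)
  rcases hqv0.eq_or_lt with hqv | hqv
  · rw [expect_g2_eq_zero hq0 hqv.symm]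
    positivity
  set t := expect q (g2 X Y (θ q) v) / expect q (fun i => inner ℝ v (X i) ^ 2) with ht
  have ht0 : 0 ≤ t := div_nonneg hN0 hqv0
  have htv : expect q (g2 X Y (θ q) v) = t * expect q (fun i => inner ℝ v (X i) ^ 2) :=
    (div_mul_cancel₀ _ hqv.ne').symm
  have htu : ∀ u, expect q (g2 X Y (θ q) u) ≤ t * expect q (fun i => inner ℝ u (X i) ^ 2) :=
    fun u => (noiseRatio_le_iff hq0 ht0).1
      ((hv u).trans ((noiseRatio_le_iff hq0 ht0).2 htv.le))
  have hp4 := expect_inner_pow_four_le (sq_nonneg κ) hF1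
  have hq4 := expect_inner_pow_four_le (by positivity) hF1q
  -- by Jensen's inequality, `κ ≥ 1` as soon as some second moment is nonzero
  have hκ1 : 1 ≤ κ := by
    have h1 := expect_sq_le_of_le hp0 (fun _ => le_rfl) hp.1.le (fun i => inner ℝ v (X i) ^ 2)
    simp only [← pow_mul, one_mul] at h1
    norm_num at h1
    by_contra! h
    have h2 := mul_lt_mul_of_pos_right (pow_lt_one₀ hκ h two_ne_zero) (pow_pos hpv 2)
    linarith [hp4 v]
  have hτq := sum_sub_min_le hε1 hp hq
  have hτp := sum_sub_min_le hε1 hq hp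
  simp only [min_comm (q _)] at hτp
  have hmain := noise_level_sq_le (ep := fun i => Y i - inner ℝ (θ p) (X i))
    (eq := fun i => Y i - inner ℝ (θ q) (X i)) (h := fun i => inner ℝ (θ p - θ q) (X i))
    (f := fun i => inner ℝ v (X i)) (a := √s) (b := √t) hp0 hq0 hτp hτq hκ
    (sq_mul_div_le hε0 hκ1 hκε) (Real.sqrt_nonneg _) (Real.sqrt_nonneg _)
    (fun i => by rw [inner_sub_left]; ring) (hp4 v) (hp4 _) (hq4 _)
    (hθp.expect_residual_mul_inner _) (hθq.expect_residual_mul_inner _)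
    (by rw [Real.sq_sqrt hs0]; exact hsu _) (by rw [Real.sq_sqrt hs0]; exact hsu _)
    (by rw [Real.sq_sqrt ht0]; exact htu _)
    (by rw [Real.sq_sqrt ht0, ← htv]; exact hqp) hpv
  rw [Real.sq_sqrt hs0, Real.sq_sqrt ht0] at hmain
  rw [htv]
  exact mul_le_mul_of_nonneg_right hmain hqv0

theorem sum_mul_sub_nonpos_iff (g : Fin n → ℝ) :
    ∑ i, g i * (q i - p i) ≤ 0 ↔ expect q g ≤ expect p g := by
  rw [← sub_nonpos (a := expect q g), ← expect_sub_weights, expect]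
  simp only [mul_comm]

end Main

end RobustRegression

theorem mainTheorem6 {n d : ℕ} (X : Fin n → EuclideanSpace ℝ (Fin d)) (Y : Fin n → ℝ)
    (ε κ σ : ℝ) (hε0 : 0 ≤ ε) (hε1 : ε < 1) (hκ : 0 ≤ κ)
    (S : Finset (Fin n)) (hS : (1 - ε) * (n : ℝ) ≤ (S.card : ℝ))
    (θ : (Fin n → ℝ) → EuclideanSpace ℝ (Fin d))
    (hθ : ∀ q ∈ deletions n ε, IsLeastSquares X Y q (θ q))
    (hF1 : F1 X (empirical S) ≤ ENNReal.ofReal (κ ^ 2))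
    (hF2 : F2 X Y θ (empirical S) ≤ ENNReal.ofReal (σ ^ 2))
    (hκε : κ ^ 3 * ε < 1 / 64) :
    (∀ q ∈ deletions n ε, ∀ E, IsMaxPseudoexpectation X q E →
      expect q (g1 X E) ≤ expect (empirical S) (g1 X E) →
        F1 X q ≤ 4 * F1 X (empirical S)) ∧
    (∀ q ∈ deletions n ε, ∀ v, IsMaxDirection X Y θ q v →
      F1 X q ≤ ENNReal.ofReal (4 * κ ^ 2) →
      expect q (g2 X Y (θ q) v) ≤ expect (empirical S) (g2 X Y (θ q) v) →
        F2 X Y θ q ≤ 3 * F2 X Y θ (empirical S)) ∧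
    (∀ E : (Fin n → ℝ) → Poly4 d →ₗ[ℝ] ℝ,
      (∀ q ∈ deletions n ε, IsMaxPseudoexpectation X q (E q)) →
        IsGeneralizedQuasiGradient (deletions n ε) (empirical S) (F1 X)
          (fun q => g1 X (E q)) 4) ∧
    (∀ v : (Fin n → ℝ) → EuclideanSpace ℝ (Fin d),
      (∀ q ∈ deletions n ε, F1 X q ≤ ENNReal.ofReal (4 * κ ^ 2) →
        IsMaxDirection X Y θ q (v q)) →
        IsGeneralizedQuasiGradient
          {q ∈ deletions n ε | F1 X q ≤ ENNReal.ofReal (4 * κ ^ 2)} (empirical S) (F2 X Y θ)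
          (fun q => g2 X Y (θ q) (v q)) 3) := by
  have hmem : ∀ q ∈ deletions n ε, empirical S ∈ deletions n ε := fun q hq =>
    empirical_mem_deletions hε1 (pos_of_mem_deletions hq) hS
  have hfin : F2 X Y θ (empirical S) ≠ ∞ := (hF2.trans_lt ENNReal.ofReal_lt_top).ne
  have part1 : ∀ q ∈ deletions n ε, ∀ E, IsMaxPseudoexpectation X q E →
      expect q (g1 X E) ≤ expect (empirical S) (g1 X E) →
        F1 X q ≤ 4 * F1 X (empirical S) := fun q hq E hE hqp =>
    F1_le_four_mul hε0 hε1 hκ hκε (hmem q hq) hq hF1 hE hqp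
  have part2 : ∀ q ∈ deletions n ε, ∀ v, IsMaxDirection X Y θ q v →
      F1 X q ≤ ENNReal.ofReal (4 * κ ^ 2) →
      expect q (g2 X Y (θ q) v) ≤ expect (empirical S) (g2 X Y (θ q) v) →
        F2 X Y θ q ≤ 3 * F2 X Y θ (empirical S) := fun q hq v hv hF1q hqp =>
    F2_le_three_mul hε0 hε1 hκ hκε (hmem q hq) hq (hθ _ (hmem q hq)) (hθ q hq) hF1 hF1q hfin
      hv hqp
  refine ⟨part1, part2, fun E hE => ⟨by norm_num, fun q hq hg => ?_⟩,
    fun v hv => ⟨by norm_num, fun q hq hg => ?_⟩⟩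
  · exact part1 q hq (E q) (hE q hq) ((sum_mul_sub_nonpos_iff _).1 hg)
  · exact part2 q hq.1 (v q) (hv q hq.1 hq.2) hq.2 ((sum_mul_sub_nonpos_iff _).1 hg)
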